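/- Let $\mathbb T^2=\mathbb R^2/\mathbb Z^2$ with standard coordinates $(x,y)$. For a Finsler metric $F$ on $\mathbb T^2$ (continuous on $T\mathbb T^2$, smooth off the zero section, positively homogeneous, positive definite and strongly convex, but not necessarily reversible) let $\pi\colon H\mathbb T^2=(T\mathbb T^2\smallsetminus 0)/\mathbb R^+\to\mathbb T^2$ be the bundle of oriented tangent directions. Let $A$ be the Hilbert form of $F$, i.e. the $1$-form on $H\mathbb T^2$ given at the direction of $v\in T_p\mathbb T^2$ by $A(Z)=\frac{d}{d\varepsilon}\big|_{\varepsilon=0}F(p,v+\varepsilon\,d\pi(Z))$, and let $X$ be its Reeb field, defined by $A(X)=1$, $i_X\,dA=0$. Let $\Omega^F$ be the volume form on $\mathbb T^2$ and $\alpha^F$ the angle $1$-form on $H\mathbb T^2$ (determined on vertical vectors) such that $\alpha^F\wedge\pi^*\Omega^F=A\wedge dA$ and $\int_{H_p\mathbb T^2}\alpha^F=2\pi$ for every $p$. The volume of $(\mathbb T^2,F)$ is the total mass of $\Omega^F$, and the Finsler--Laplacian is $$\Delta^F f(p)=\frac1\pi\int_{H_p\mathbb T^2}L_X^2(\pi^*f)\,\alpha^F,\qquad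 f\in C^2(\mathbb T^2).$$ Let $0=\lambda_0(F)\le\lambda_1(F)\le\dots$ be the eigenvalues of $-\Delta^F$, counted with multiplicity. Let $h>1$ and $g_0=h^2\,dx^2+h^{-2}\,dy^2$, and for $0\le\eta<1$ put $F_\eta=\sqrt{g_0}+\eta h\,dx$. Then for every $0\le\eta<1$ the function $F_\eta$ is a Randers metric, that is, the $1$-form $\eta h\,dx$ has norm less than $1$ for the dual metric of $g_0$; it is a Finsler metric, and the volume of $(\mathbb T^2,F_\eta)$ is $1$. Moreover, there is $\eta_0<1$, depending on $h$, such that for all $\eta\in[0,1)$ with $\eta>\eta_0$ $$\lambda_1(F_\eta)\ge 4\pi^2h^2.$$ -/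

import Mathlib

open scoped ContDiff Matrix

noncomputable section

namespace FinslerTorus

/-- The torus `ℝ² / ℤ²`. -/
abbrev T2 : Type := UnitAddTorus (Fin 2)

/-- The plane: the universal cover of the torus, and also each of its tangent spaces
(the tangent bundle is trivialised by the standard coordinates). -/
abbrev Plane : Type := Fin 2 → ℝ

/-- The covering projection `ℝ² → ℝ² / ℤ²`. -/
def proj (p : Plane) : T2 := fun i => (p i : UnitAddCircle)

/-! ### Finsler and Randers metrics -/

/-- Finsler metrics on the torus. A function on the tangent bundle is `F x v`, with `x` a point
of the torus and `v` a tangent vector at `x` in the standard coordinates. -/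
structure IsFinslerMetric (F : T2 → Plane → ℝ) : Prop where
  continuous : Continuous fun q : T2 × Plane => F q.1 q.2
  smooth : ContDiffOn ℝ ∞ (fun q : Plane × Plane => F (proj q.1) q.2) {q | q.2 ≠ 0}
  homogeneous : ∀ (x : T2) (v : Plane) (c : ℝ), 0 < c → F x (c • v) = c * F x v
  nonneg : ∀ (x : T2) (v : Plane), 0 ≤ F x v
  eq_zero_iff : ∀ (x : T2) (v : Plane), F x v = 0 ↔ v = 0
  strongly_convex : ∀ (x : T2) (v w : Plane), v ≠ 0 → w ≠ 0 →
    0 < fderiv ℝ (fderiv ℝ fun u : Plane => F x u ^ 2) v w w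

/-- The function `√g + ρ` on the tangent bundle, for a field `g` of symmetric matrices and a
`1`-form `ρ` (given by its components). -/
def randers (g : T2 → Matrix (Fin 2) (Fin 2) ℝ) (ρ : T2 → Plane) (x : T2) (v : Plane) : ℝ :=
  √(v ⬝ᵥ (g x *ᵥ v)) + ρ x ⬝ᵥ v

/-- Randers metrics: `F = √g + ρ` with `g` a smooth Riemannian metric and `ρ` a smooth `1`-form
whose norm for the dual metric `g⁻¹` is everywhere less than `1`. -/
def IsRandersMetric (F : T2 → Plane → ℝ) : Prop :=
  ∃ (g : T2 → Matrix (Fin 2) (Fin 2) ℝ) (ρ : T2 → Plane),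
    (∀ i j, ContDiff ℝ ∞ fun p : Plane => g (proj p) i j) ∧
    (∀ i, ContDiff ℝ ∞ fun p : Plane => ρ (proj p) i) ∧
    (∀ x, (g x).PosDef) ∧
    (∀ x, √(ρ x ⬝ᵥ ((g x)⁻¹ *ᵥ ρ x)) < 1) ∧
    F = randers g ρ

/-! ### The homogenized bundle and the Hilbert form

The homogenized bundle `HM` (nonzero tangent vectors up to positive scaling) of the torus is
`T² × S¹`. Its points are written in coordinates `((x, y), θ)`, which stand for the base point
`(x, y)` mod `ℤ²` and the ray spanned by `(cos θ, sin θ)`; objects on `HM` are given by their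
pull-backs to this universal cover. -/

/-- The universal cover of the homogenized bundle. -/
abbrev HPlane : Type := Plane × ℝ

/-- The representative `(cos θ, sin θ)` of a direction. -/
def dir (θ : ℝ) : Plane := ![Real.cos θ, Real.sin θ]

/-- The Hilbert form: `A(Z) = lim (F(x, v + ε dπ(Z)) - F(x, v)) / ε`, where `v` represents the
direction and `π` is the projection to the base. -/
def hilbertForm (F : T2 → Plane → ℝ) (q : HPlane) : HPlane →L[ℝ] ℝ :=
  (fderiv ℝ (F (proj q.1)) (dir q.2)).comp (ContinuousLinearMap.fst ℝ Plane ℝ)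

/-- The exterior derivative `dA` of the Hilbert form. -/
def dHilbertForm (F : T2 → Plane → ℝ) : HPlane → HPlane [⋀^Fin 2]→L[ℝ] ℝ :=
  extDeriv fun q => ContinuousAlternatingMap.ofSubsingleton ℝ HPlane ℝ (0 : Fin 1) (hilbertForm F q)

/-- The `3`-form `A ∧ dA`, evaluated on three tangent vectors. -/
def contactVolume (F : T2 → Plane → ℝ) (q u v w : HPlane) : ℝ :=
  hilbertForm F q u * dHilbertForm F q ![v, w] + hilbertForm F q v * dHilbertForm F q ![w, u] +
    hilbertForm F q w * dHilbertForm F q ![u, v]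

/-- The coordinate vector field `∂/∂x`. -/
def ex : HPlane := (![1, 0], 0)

/-- The coordinate vector field `∂/∂y`. -/
def ey : HPlane := (![0, 1], 0)

/-- The coordinate vector field `∂/∂θ`, which spans the vertical bundle. -/
def eθ : HPlane := (0, 1)

/-- The Reeb field of `A`: the vector field with `A(X) = 1` and `i_X dA = 0`
(it exists and is unique when `F` is a Finsler metric). -/
def reeb (F : T2 → Plane → ℝ) (q : HPlane) : HPlane :=
  Classical.epsilon fun X => hilbertForm F q X = 1 ∧ ∀ w, dHilbertForm F q ![X, w] = 0

/-! ### Volume and angle forms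

The forms `Ω` on the torus and `α` on `HM` are determined by `α ∧ π^*Ω = A ∧ dA` and
`∫_{H_x M} α = 2π`, the fibre being oriented by increasing `θ`. Writing `Ω = ω dx ∧ dy` and
`a = α(∂/∂θ)`, the first equation reads `a ω = (A ∧ dA)(∂/∂θ, ∂/∂x, ∂/∂y)`. -/

/-- The component `ω` of the volume form `Ω = ω dx ∧ dy`. -/
def volumeForm (F : T2 → Plane → ℝ) (p : Plane) : ℝ :=
  (2 * Real.pi)⁻¹ * ∫ θ in (0 : ℝ)..(2 * Real.pi), contactVolume F (p, θ) eθ ex ey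

/-- The component `α(∂/∂θ)` of the angle form. -/
def angleForm (F : T2 → Plane → ℝ) (q : HPlane) : ℝ :=
  contactVolume F q eθ ex ey / volumeForm F q.1

/-- The two defining equations leave no other choice for `Ω` and for `α` on vertical vectors. -/
theorem volumeForm_angleForm_unique (F : T2 → Plane → ℝ) (p : Plane) (m : ℝ) (a : ℝ → ℝ)
    (hm : m ≠ 0) (h : ∀ θ, a θ * m = contactVolume F (p, θ) eθ ex ey)
    (ha : ∫ θ in (0 : ℝ)..(2 * Real.pi), a θ = 2 * Real.pi) :
    m = volumeForm F p ∧ ∀ θ, a θ = angleForm F (p, θ) := by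
  have h1 : m = volumeForm F p := by
    have hpi := Real.pi_ne_zero
    simp only [volumeForm, ← h, intervalIntegral.integral_mul_const, ha]
    field_simp
  refine ⟨h1, fun θ => ?_⟩
  simp only [angleForm, ← h, ← h1]
  field_simp

/-- The total volume of the torus, the integral of `|Ω|` over a fundamental domain. -/
def totalVolume (F : T2 → Plane → ℝ) : ℝ :=
  ∫ p in Set.Icc (0 : Plane) 1, |volumeForm F p|

/-! ### The Finsler-Laplacian and its spectrum -/

/-- The Lie derivative along the Reeb field of a function on the homogenized bundle. -/
def lieReeb (F : T2 → Plane → ℝ) (φ : HPlane → ℝ) (q : HPlane) : ℝ :=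
  fderiv ℝ φ q (reeb F q)

/-- The Finsler-Laplacian `Δ f (x) = n / vol(S^{n-1}) ∫_{H_x M} L_X² (π^* f) α` for `n = 2`. -/
def laplacian (F : T2 → Plane → ℝ) (f : T2 → ℝ) (p : Plane) : ℝ :=
  2 / (2 * Real.pi) * ∫ θ in (0 : ℝ)..(2 * Real.pi),
    lieReeb F (lieReeb F fun q => f (proj q.1)) (p, θ) * angleForm F (p, θ)

/-- `f` is an eigenfunction of `-Δ` for the eigenvalue `μ`. -/
def IsEigenfunction (F : T2 → Plane → ℝ) (μ : ℝ) (f : T2 → ℝ) : Prop :=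
  (ContDiff ℝ 2 fun p => f (proj p)) ∧ f ≠ 0 ∧ ∀ p, -laplacian F f p = μ * f (proj p)

/-- `lam` is the `k`-th eigenvalue of `-Δ` in the list `0 = λ₀ ≤ λ₁ ≤ λ₂ ≤ ⋯` in which every
eigenvalue is repeated according to its multiplicity: the least number such that there are
`k + 1` linearly independent eigenfunctions with eigenvalues at most `lam`. -/
def IsKthEigenvalue (F : T2 → Plane → ℝ) (k : ℕ) (lam : ℝ) : Prop :=
  IsLeast {t : ℝ | ∃ f : Fin (k + 1) → T2 → ℝ, LinearIndependent ℝ f ∧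
    ∀ i, ∃ μ ≤ t, IsEigenfunction F μ (f i)} lam

/-! ### The example -/

/-- The Randers metric `√g₀ + η h dx` with `g₀ = diag(h², h⁻²)`. -/
def torusRanders (h η : ℝ) : T2 → Plane → ℝ :=
  randers (fun _ => !![h ^ 2, 0; 0, h⁻¹ ^ 2]) (fun _ => ![η * h, 0])

end FinslerTorus

end

noncomputable section

namespace FinslerTorus

section Fourier

open MeasureTheory UnitAddTorus

/-! ### Calculus and Fourier coefficients on the torus -/

/-! The linear map (x, y) ↦ (hx, h⁻¹y) has determinant one and carries g₀ to the Euclidean metric.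
In the resulting angle φ the unit g₀-circle has F = 1 + η cos φ. The metric is translation
invariant, so the Hilbert form has coefficients depending only on the direction; its Reeb field
keeps the direction and moves along straight lines with F-speed one. Up to a common sign of
orientation, A ∧ dA is (1 + η cos φ) dφ ∧ dx ∧ dy. Since cos has mean zero, the volume form is the
Euclidean one and the angle form is (1 + η cos φ) dφ.

Hence Δf is the average of D²f(u, u) / (1 + η cos φ) over the g₀-unit vectors u, normalised by 1/π.
With s = √(1 - η²), this gives P ∂ₓ² + Q ∂ᵧ², where P = 2 / (h² s (1 + s)) and Q = 2h² / (1 + s)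
(`laplacian_torusRanders`, via `integral_comp_isoAngle` and the integrals of cos² and sin² against 1
/ (1 + η cos φ)). Fourier series give λ₁ = 4π² min(P, Q) (`isKthEigenvalue_one`). Always Q ≥ h²
because s ≤ 1, while P tends to infinity as η tends to 1: the weight concentrates at φ = π, where
cos² = 1 and sin² = 0. -/

theorem proj_add (p q : Plane) : proj (p + q) = proj p + proj q := by
  ext i; simp [proj]

theorem proj_zero : proj 0 = 0 := by
  ext i; simp [proj]

theorem isOpenQuotientMap_proj : IsOpenQuotientMap proj :=
  IsOpenQuotientMap.piMap fun _ => QuotientAddGroup.isOpenQuotientMap_mk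

theorem surjective_proj : Function.Surjective proj := isOpenQuotientMap_proj.surjective

theorem continuous_of_comp_proj {X : Type*} [TopologicalSpace X] {g : T2 → X}
    (hg : Continuous fun p => g (proj p)) : Continuous g :=
  isOpenQuotientMap_proj.continuous_comp_iff.1 hg

/-- The partial derivative in the `i`-th coordinate of a function on the torus. -/
def partialDeriv (i : Fin 2) (g : T2 → ℝ) (x : T2) : ℝ :=
  deriv (fun s : ℝ => g (x + proj (Pi.single i s))) 0

theorem hasDerivAt_add_single {g : T2 → ℝ} (hg : Differentiable ℝ fun p => g (proj p))
    (i : Fin 2) (p : Plane) (s : ℝ) :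
    HasDerivAt (fun s : ℝ => g (proj p + proj (Pi.single i s)))
      (fderiv ℝ (fun p => g (proj p)) (p + Pi.single i s) (Pi.single i 1)) s := by
  have h1 : HasDerivAt (fun s : ℝ => p + Pi.single i s) (Pi.single i (1 : ℝ)) s := by
    refine HasDerivAt.const_add p ?_
    rw [hasDerivAt_pi]
    intro j
    rcases eq_or_ne j i with rfl | hj
    · simpa using hasDerivAt_id' s
    · simpa [hj] using hasDerivAt_const s (0 : ℝ)
  have h2 := (hg (p + Pi.single i s)).hasFDerivAt.comp_hasDerivAt s h1
  simpa only [Function.comp_def, proj_add] using h2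

theorem partialDeriv_proj {g : T2 → ℝ} (hg : Differentiable ℝ fun p => g (proj p))
    (i : Fin 2) (p : Plane) :
    partialDeriv i g (proj p) = fderiv ℝ (fun p => g (proj p)) p (Pi.single i 1) := by
  simpa [partialDeriv] using (hasDerivAt_add_single hg i p 0).deriv

theorem hasDerivAt_partialDeriv {g : T2 → ℝ} (hg : Differentiable ℝ fun p => g (proj p))
    (i : Fin 2) (x : T2) (s : ℝ) :
    HasDerivAt (fun s : ℝ => g (x + proj (Pi.single i s)))
      (partialDeriv i g (x + proj (Pi.single i s))) s := by
  obtain ⟨p, rfl⟩ := surjective_proj x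
  rw [← proj_add, partialDeriv_proj hg]
  exact hasDerivAt_add_single hg i p s

theorem contDiff_partialDeriv {g : T2 → ℝ} {m k : WithTop ℕ∞}
    (hg : ContDiff ℝ k fun p => g (proj p)) (hmk : m + 1 ≤ k) (i : Fin 2) :
    ContDiff ℝ m fun p => partialDeriv i g (proj p) := by
  have hd : Differentiable ℝ fun p => g (proj p) :=
    hg.differentiable (ne_of_gt (lt_of_lt_of_le (by simp) hmk))
  simp only [partialDeriv_proj hd]
  exact (hg.fderiv_right hmk).clm_apply contDiff_const

/-- The Haar probability measure of the torus. -/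
def torusMeasure : Measure T2 := Measure.pi fun _ => AddCircle.haarAddCircle

instance : Measure.IsAddHaarMeasure torusMeasure := by
  unfold torusMeasure; infer_instance

instance : IsProbabilityMeasure torusMeasure := by
  unfold torusMeasure; infer_instance

theorem mFourierCoeff_eq (g : T2 → ℂ) (n : Fin 2 → ℤ) :
    mFourierCoeff g n = ∫ x, mFourier (-n) x * g x ∂torusMeasure := rfl

theorem integrable_torus {g : T2 → ℂ} (hg : Continuous g) : Integrable g torusMeasure :=
  hg.integrable_of_hasCompactSupport (HasCompactSupport.of_compactSpace g)

theorem mFourier_apply_add (n : Fin 2 → ℤ) (x y : T2) :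
    mFourier n (x + y) = mFourier n x * mFourier n y := by
  simp [mFourier, Fin.prod_univ_two, fourier_apply, AddCircle.toCircle_add, smul_add]
  ring

theorem mFourier_proj_single (n : Fin 2 → ℤ) (i : Fin 2) (s : ℝ) :
    mFourier n (proj (Pi.single i s)) = Complex.exp (2 * Real.pi * Complex.I * n i * s) := by
  fin_cases i <;> simp [mFourier, proj, Fin.prod_univ_two, fourier_coe_apply, fourier_eval_zero,
    -fourier_apply]

/-- Translation invariance of Haar measure replaces integration by parts: translating g by s in
direction i multiplies its n-th coefficient by exp(2πi nᵢ s), and both sides are differentiated at s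
= 0. -/
theorem mFourierCoeff_partialDeriv {g : T2 → ℝ} (hg : ContDiff ℝ 1 fun p => g (proj p))
    (i : Fin 2) (n : Fin 2 → ℤ) :
    mFourierCoeff (fun x => (partialDeriv i g x : ℂ)) n =
      2 * Real.pi * Complex.I * n i * mFourierCoeff (fun x => (g x : ℂ)) n := by
  have hgc : Continuous g := continuous_of_comp_proj hg.continuous
  have hdc : Continuous (partialDeriv i g) :=
    continuous_of_comp_proj (contDiff_partialDeriv (m := 0) hg (by simp) i).continuous
  have hd : Differentiable ℝ fun p => g (proj p) := hg.differentiable one_ne_zero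
  -- The partial derivative is bounded by compactness and characters have modulus one, so a constant
  -- dominates the difference quotients.
  obtain ⟨C, hC⟩ := (isCompact_univ (X := T2)).exists_bound_of_continuousOn
    (f := fun x => (partialDeriv i g x : ℂ)) (by fun_prop)
  have h1 : HasDerivAt
      (fun s : ℝ => ∫ x, mFourier (-n) x * (g (x + proj (Pi.single i s)) : ℂ) ∂torusMeasure)
      (∫ x, mFourier (-n) x * (partialDeriv i g (x + proj (Pi.single i 0)) : ℂ) ∂torusMeasure)
      0 := by
    refine (hasDerivAt_integral_of_dominated_loc_of_deriv_le (s := Set.univ)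
      (F := fun (s : ℝ) x => mFourier (-n) x * (g (x + proj (Pi.single i s)) : ℂ))
      (F' := fun (s : ℝ) x => mFourier (-n) x * (partialDeriv i g (x + proj (Pi.single i s)) : ℂ))
      (bound := fun _ => C) Filter.univ_mem ?_ ?_ ?_ ?_ (integrable_const C) ?_).2
    · exact .of_forall fun s => Continuous.aestronglyMeasurable (by fun_prop)
    · exact integrable_torus (by fun_prop)
    · exact Continuous.aestronglyMeasurable (by fun_prop)
    · refine .of_forall fun x s _ => ?_
      have h2 := (mFourier (-n)).norm_coe_le_norm x
      rw [mFourier_norm] at h2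
      rw [norm_mul]
      have h3 := hC (x + proj (Pi.single i s)) (Set.mem_univ _)
      nlinarith [norm_nonneg (partialDeriv i g (x + proj (Pi.single i s)) : ℂ)]
    · exact .of_forall fun x s _ =>
        ((hasDerivAt_partialDeriv hd i x s).ofReal_comp).const_mul _
  have h2 : (fun s : ℝ => ∫ x, mFourier (-n) x * (g (x + proj (Pi.single i s)) : ℂ)
      ∂torusMeasure) = fun s : ℝ => Complex.exp (2 * Real.pi * Complex.I * n i * s) *
        mFourierCoeff (fun x => (g x : ℂ)) n := by
    funext s
    rw [mFourierCoeff_eq, ← integral_const_mul, ← integral_add_right_eq_self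
      (μ := torusMeasure) (fun x => Complex.exp (2 * Real.pi * Complex.I * n i * s) *
        (mFourier (-n) x * (g x : ℂ))) (proj (Pi.single i s))]
    congr 1
    funext x
    rw [mFourier_apply_add, mFourier_proj_single]
    have : Complex.exp (2 * Real.pi * Complex.I * n i * s) *
        Complex.exp (2 * Real.pi * Complex.I * ((-n) i : ℤ) * s) = 1 := by
      rw [← Complex.exp_add]
      simp
    linear_combination (-(mFourier (-n) x * (g (x + proj (Pi.single i s)) : ℂ))) * this
  have h3 : HasDerivAt (fun s : ℝ => Complex.exp (2 * Real.pi * Complex.I * n i * s) *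
        mFourierCoeff (fun x => (g x : ℂ)) n)
      (2 * Real.pi * Complex.I * n i * mFourierCoeff (fun x => (g x : ℂ)) n) 0 := by
    have h4 : HasDerivAt (fun s : ℝ => 2 * Real.pi * Complex.I * n i * (s : ℂ))
        (2 * Real.pi * Complex.I * n i) 0 := by
      simpa using (Complex.ofRealCLM.hasDerivAt (x := (0 : ℝ))).const_mul
        (2 * Real.pi * Complex.I * (n i : ℂ))
    simpa using h4.cexp.mul_const (mFourierCoeff (fun x => (g x : ℂ)) n)
  rw [h2] at h1
  have h5 := h1.unique h3
  simp only [Pi.single_zero, proj_zero, add_zero] at h5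
  rw [mFourierCoeff_eq, h5]

/-- Only one coefficient can be nonzero, so the Fourier series is summable and converges pointwise
to g. -/
theorem eq_const_of_mFourierCoeff_eq_zero {g : T2 → ℝ} (hg : Continuous g)
    (h : ∀ n : Fin 2 → ℤ, n ≠ 0 → mFourierCoeff (fun x => (g x : ℂ)) n = 0) :
    ∃ c : ℝ, ∀ x, g x = c := by
  let G : C(T2, ℂ) := ⟨fun x => (g x : ℂ), by fun_prop⟩
  have hG : ∀ n : Fin 2 → ℤ, n ≠ 0 → mFourierCoeff G n = 0 := h
  have hs : Summable (mFourierCoeff G) :=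
    summable_of_ne_finset_zero (s := {0}) fun n hn => hG n (by simpa using hn)
  have h1 : ∀ x, (g x : ℂ) = mFourierCoeff G 0 := by
    intro x
    have h2 := hasSum_mFourier_series_apply_of_summable hs x
    have h3 := hasSum_single (f := fun i => mFourierCoeff G i • mFourier i x) 0
      fun n hn => by simp [hG n hn]
    have h4 := h2.unique h3
    simpa [mFourier_zero, G] using h4
  refine ⟨(mFourierCoeff G 0).re, fun x => ?_⟩
  rw [← h1 x, Complex.ofReal_re]

/-- Eigenfunctions of the operator `-(P ∂₀² + Q ∂₁²)` for an eigenvalue below `4π² P` and `4π² Q`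
are constant. -/
theorem eq_const_of_eigenvalue_lt {P Q μ : ℝ} {f : T2 → ℝ}
    (hP : μ < 4 * Real.pi ^ 2 * P) (hQ : μ < 4 * Real.pi ^ 2 * Q) (hP0 : 0 < P) (hQ0 : 0 < Q)
    (hf : ContDiff ℝ 2 fun p => f (proj p))
    (h : ∀ x, -(P * partialDeriv 0 (partialDeriv 0 f) x + Q * partialDeriv 1 (partialDeriv 1 f) x) =
      μ * f x) :
    ∃ c : ℝ, ∀ x, f x = c := by
  have hf1 : ContDiff ℝ 1 fun p => f (proj p) := hf.of_le (by norm_num)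
  have hd : ∀ i, ContDiff ℝ 1 fun p => partialDeriv i f (proj p) := fun i =>
    contDiff_partialDeriv hf (by norm_num [one_add_one_eq_two]) i
  have hc2 : ∀ i, Continuous (partialDeriv i (partialDeriv i f)) := fun i =>
    continuous_of_comp_proj (contDiff_partialDeriv (m := 0) (hd i) (by simp) i).continuous
  have hc0 := hc2 0
  have hc1 := hc2 1
  have hfc : Continuous f := continuous_of_comp_proj hf.continuous
  refine eq_const_of_mFourierCoeff_eq_zero hfc fun n hn => ?_
  have e : ∀ i, mFourierCoeff (fun x => (partialDeriv i (partialDeriv i f) x : ℂ)) n =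
      -(4 * Real.pi ^ 2 * (n i) ^ 2) * mFourierCoeff (fun x => (f x : ℂ)) n := by
    intro i
    rw [mFourierCoeff_partialDeriv (hd i), mFourierCoeff_partialDeriv hf1]
    linear_combination (4 * Real.pi ^ 2 * (n i : ℂ) ^ 2 * mFourierCoeff (fun x => (f x : ℂ)) n) *
      Complex.I_sq
  have h1 : (μ : ℂ) * mFourierCoeff (fun x => (f x : ℂ)) n =
      -(P * mFourierCoeff (fun x => (partialDeriv 0 (partialDeriv 0 f) x : ℂ)) n +
        Q * mFourierCoeff (fun x => (partialDeriv 1 (partialDeriv 1 f) x : ℂ)) n) := by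
    simp only [mFourierCoeff_eq]
    rw [← integral_const_mul, ← integral_const_mul, ← integral_const_mul, ← integral_add,
      ← integral_neg]
    · congr 1
      funext x
      have h2 : -(P * (partialDeriv 0 (partialDeriv 0 f) x : ℂ) +
          Q * (partialDeriv 1 (partialDeriv 1 f) x : ℂ)) = μ * (f x : ℂ) := by
        exact_mod_cast h x
      linear_combination (-(mFourier (-n) x)) * h2
    · exact integrable_torus (by fun_prop)
    · exact integrable_torus (by fun_prop)
  rw [e 0, e 1] at h1
  -- The symbol of the operator minus μ kills each coefficient; for n ≠ 0 some nᵢ² ≥ 1, so the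
  -- symbol exceeds μ.
  have h3 : ((4 * Real.pi ^ 2 * (P * n 0 ^ 2 + Q * n 1 ^ 2) - μ : ℝ) : ℂ) *
      mFourierCoeff (fun x => (f x : ℂ)) n = 0 := by
    push_cast
    linear_combination -h1
  refine (mul_eq_zero.1 h3).resolve_left ?_
  rw [Complex.ofReal_eq_zero]
  have hpi : 0 < 4 * Real.pi ^ 2 := by positivity
  have key : ∀ m : ℤ, m ≠ 0 → (1 : ℝ) ≤ (m : ℝ) ^ 2 := fun m hm => by
    exact_mod_cast Int.one_le_abs hm |> fun h => (one_le_sq_iff_one_le_abs m).2 h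
  refine ne_of_gt (sub_pos.2 ?_)
  by_cases h0 : n 0 = 0
  · have h1 : n 1 ≠ 0 := fun h1 => hn (by ext i; fin_cases i <;> simp [h0, h1])
    calc μ < 4 * Real.pi ^ 2 * Q := hQ
      _ ≤ _ := by
        refine mul_le_mul_of_nonneg_left ?_ hpi.le
        nlinarith [key _ h1, mul_nonneg hP0.le (sq_nonneg (n 0 : ℝ))]
  · calc μ < 4 * Real.pi ^ 2 * P := hP
      _ ≤ _ := by
        refine mul_le_mul_of_nonneg_left ?_ hpi.le
        nlinarith [key _ h0, mul_nonneg hQ0.le (sq_nonneg (n 1 : ℝ))]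

end Fourier

/-! ### The metric `√g₀ + η h dx` -/

/-- The norm of the metric `g₀ = diag(h², h⁻²)`. -/
def gnorm (h : ℝ) (v : Plane) : ℝ := √(h ^ 2 * v 0 ^ 2 + h⁻¹ ^ 2 * v 1 ^ 2)

theorem torusRanders_apply (h η : ℝ) (x : T2) (v : Plane) :
    torusRanders h η x v = gnorm h v + η * h * v 0 := by
  simp only [torusRanders, randers, gnorm, dotProduct, Matrix.mulVec, Fin.sum_univ_two]
  simp
  ring_nf

theorem gnorm_sq_arg_pos {h : ℝ} (hh : h ≠ 0) {v : Plane} (hv : v ≠ 0) :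
    0 < h ^ 2 * v 0 ^ 2 + h⁻¹ ^ 2 * v 1 ^ 2 := by
  have h0 : 0 < h ^ 2 := by positivity
  have h1 : 0 < h⁻¹ ^ 2 := by positivity
  by_cases hv0 : v 0 = 0
  · have hv1 : v 1 ≠ 0 := fun hv1 => hv (by ext i; fin_cases i <;> simp [hv0, hv1])
    positivity
  · positivity

theorem gnorm_pos {h : ℝ} (hh : h ≠ 0) {v : Plane} (hv : v ≠ 0) : 0 < gnorm h v :=
  Real.sqrt_pos.2 (gnorm_sq_arg_pos hh hv)

theorem gnorm_sq (h : ℝ) (v : Plane) :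
    gnorm h v ^ 2 = h ^ 2 * v 0 ^ 2 + h⁻¹ ^ 2 * v 1 ^ 2 :=
  Real.sq_sqrt (by positivity)

theorem abs_le_gnorm (h : ℝ) (v : Plane) : |h * v 0| ≤ gnorm h v := by
  refine Real.abs_le_sqrt ?_
  nlinarith [sq_nonneg (h⁻¹ * v 1)]

theorem mul_gnorm_le_torusRanders {h η : ℝ} (hη : 0 ≤ η) (x : T2) (v : Plane) :
    (1 - η) * gnorm h v ≤ torusRanders h η x v := by
  rw [torusRanders_apply]
  nlinarith [abs_le_gnorm h v, neg_abs_le (h * v 0)]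

theorem torusRanders_pos {h η : ℝ} (hh : h ≠ 0) (hη : 0 ≤ η) (hη1 : η < 1) (x : T2) {v : Plane}
    (hv : v ≠ 0) : 0 < torusRanders h η x v :=
  lt_of_lt_of_le (mul_pos (by linarith) (gnorm_pos hh hv)) (mul_gnorm_le_torusRanders hη x v)

theorem isRandersMetric_torusRanders {h η : ℝ} (hh : h ≠ 0) (hη : 0 ≤ η) (hη1 : η < 1) :
    IsRandersMetric (torusRanders h η) := by
  refine ⟨_, _, fun i j => contDiff_const, fun i => contDiff_const, fun x => ?_, fun x => ?_, rfl⟩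
  · have : (!![h ^ 2, 0; 0, h⁻¹ ^ 2] : Matrix (Fin 2) (Fin 2) ℝ) =
        Matrix.diagonal ![h ^ 2, h⁻¹ ^ 2] := by
      ext i j; fin_cases i <;> fin_cases j <;> simp
    rw [this]
    refine Matrix.PosDef.diagonal fun i => ?_
    fin_cases i <;> simp <;> positivity
  · have : (!![h ^ 2, 0; 0, h⁻¹ ^ 2] : Matrix (Fin 2) (Fin 2) ℝ)⁻¹ = !![h⁻¹ ^ 2, 0; 0, h ^ 2] := by
      refine Matrix.inv_eq_right_inv ?_
      ext i j; fin_cases i <;> fin_cases j <;> simp [hh]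
    rw [this]
    simp only [dotProduct, Matrix.mulVec, Fin.sum_univ_two]
    simp
    rw [show η * h * ((h ^ 2)⁻¹ * (η * h)) = η ^ 2 by field_simp, Real.sqrt_sq hη]
    exact hη1

/-- The differential of `√g₀ + η h dx` at a nonzero vector. -/
def covec (h η : ℝ) (v : Plane) : Plane →L[ℝ] ℝ :=
  (h ^ 2 * v 0 / gnorm h v + η * h) • ContinuousLinearMap.proj 0 +
    (h⁻¹ ^ 2 * v 1 / gnorm h v) • ContinuousLinearMap.proj 1

theorem covec_apply (h η : ℝ) (v w : Plane) :
    covec h η v w = (h ^ 2 * v 0 / gnorm h v + η * h) * w 0 + h⁻¹ ^ 2 * v 1 / gnorm h v * w 1 := by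
  simp [covec]

theorem hasFDerivAt_torusRanders {h : ℝ} (hh : h ≠ 0) (η : ℝ) (x : T2) {v : Plane} (hv : v ≠ 0) :
    HasFDerivAt (torusRanders h η x) (covec h η v) v := by
  have h0 : HasFDerivAt (fun u : Plane => u 0) (ContinuousLinearMap.proj 0) v :=
    (ContinuousLinearMap.proj 0 : Plane →L[ℝ] ℝ).hasFDerivAt
  have h1 : HasFDerivAt (fun u : Plane => u 1) (ContinuousLinearMap.proj 1) v :=
    (ContinuousLinearMap.proj 1 : Plane →L[ℝ] ℝ).hasFDerivAt
  have h2 := ((((h0.pow 2).const_mul (h ^ 2)).add ((h1.pow 2).const_mul (h⁻¹ ^ 2))).sqrt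
    (gnorm_sq_arg_pos hh hv).ne').add (h0.const_mul (η * h))
  have h3 : torusRanders h η x = fun u => gnorm h u + η * h * u 0 :=
    funext (torusRanders_apply h η x)
  rw [h3]
  refine h2.congr_fderiv ?_
  have hg := gnorm_pos hh hv
  ext w
  simp only [covec_apply]
  simp only [Pi.add_apply, add_apply, smul_apply,
    ContinuousLinearMap.proj_apply, smul_eq_mul, nsmul_eq_mul,
    ← show gnorm h v = √(h ^ 2 * v 0 ^ 2 + h⁻¹ ^ 2 * v 1 ^ 2) from rfl]
  norm_num
  field_simp
  ring

/-- F ignores the base point, so y needs no regularity; this covers both F on one tangent space and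
F on the whole tangent bundle. -/
theorem contDiffAt_torusRanders {h : ℝ} (hh : h ≠ 0) (η : ℝ) {X : Type*} [NormedAddCommGroup X]
    [NormedSpace ℝ X] {y : X → T2} {u : X → Plane} {q : X} (hu : ContDiff ℝ ∞ u) (hq : u q ≠ 0) :
    ContDiffAt ℝ ∞ (fun q => torusRanders h η (y q) (u q)) q := by
  simp only [torusRanders_apply, gnorm]
  have hu' : ∀ i, ContDiffAt ℝ ∞ (fun q => u q i) q := fun i =>
    (contDiff_pi.1 hu i).contDiffAt
  refine ContDiffAt.add (ContDiffAt.sqrt ?_ (gnorm_sq_arg_pos hh hq).ne')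
    (contDiffAt_const.mul (hu' 0))
  exact (contDiffAt_const.mul ((hu' 0).pow 2)).add (contDiffAt_const.mul ((hu' 1).pow 2))

/-! ### Strong convexity -/

theorem hasDerivAt_fderiv_add_smul {G : Plane → ℝ} {v : Plane}
    (hG : DifferentiableAt ℝ (fderiv ℝ G) v) (w : Plane) :
    HasDerivAt (fun t : ℝ => fderiv ℝ G (v + t • w) w) (fderiv ℝ (fderiv ℝ G) v w w) 0 := by
  have hline : HasDerivAt (fun t : ℝ => v + t • w) w 0 := by
    simpa using ((hasDerivAt_id' (0 : ℝ)).smul_const w).const_add v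
  have h1 : HasFDerivAt (fderiv ℝ G) (fderiv ℝ (fderiv ℝ G) v) (v + (0 : ℝ) • w) := by
    simpa using hG.hasFDerivAt
  exact ((ContinuousLinearMap.apply ℝ ℝ w).hasFDerivAt).comp_hasDerivAt (0 : ℝ)
    (h1.comp_hasDerivAt (0 : ℝ) hline)

/-- The expression is half the Hessian of F² at v, namely (dF w)² + F · D²F(w, w), with N the
g₀-norm of v. By Lagrange's identity and det g₀ = 1, D²F(w, w) = (v₀w₁ - v₁w₀)² / N³, which is
positive unless w is parallel to v. In that case b / N is ± the g₀-norm of w, which η h w₀ cannot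
cancel since η < 1. -/
theorem hessian_pos {h η F N : ℝ} {v w : Plane} (hh : h ≠ 0) (hη : 0 ≤ η) (hη1 : η < 1)
    (hw : w ≠ 0) (hF : 0 < F) (hN : 0 < N)
    (hNsq : N ^ 2 = h ^ 2 * v 0 ^ 2 + h⁻¹ ^ 2 * v 1 ^ 2) :
    0 < ((h ^ 2 * v 0 * w 0 + h⁻¹ ^ 2 * v 1 * w 1) / N + η * h * w 0) ^ 2 +
      F * ((h ^ 2 * w 0 ^ 2 + h⁻¹ ^ 2 * w 1 ^ 2) / N -
        (h ^ 2 * v 0 * w 0 + h⁻¹ ^ 2 * v 1 * w 1) ^ 2 / N ^ 3) := by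
  have hqpos := gnorm_sq_arg_pos hh hw
  have hid : (h ^ 2 * w 0 ^ 2 + h⁻¹ ^ 2 * w 1 ^ 2) * N ^ 2 -
      (h ^ 2 * v 0 * w 0 + h⁻¹ ^ 2 * v 1 * w 1) ^ 2 = (v 0 * w 1 - v 1 * w 0) ^ 2 := by
    rw [hNsq]; field_simp; ring
  have hlin : (η * h * w 0) ^ 2 ≤ η ^ 2 * (h ^ 2 * w 0 ^ 2 + h⁻¹ ^ 2 * w 1 ^ 2) := by
    nlinarith [mul_nonneg (sq_nonneg η) (sq_nonneg (h⁻¹ * w 1))]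
  generalize h ^ 2 * v 0 * w 0 + h⁻¹ ^ 2 * v 1 * w 1 = b at *
  generalize h ^ 2 * w 0 ^ 2 + h⁻¹ ^ 2 * w 1 ^ 2 = q at *
  have e2 : q / N - b ^ 2 / N ^ 3 = (v 0 * w 1 - v 1 * w 0) ^ 2 / N ^ 3 := by
    rw [← hid]; field_simp
  rw [e2]
  by_cases hc : v 0 * w 1 - v 1 * w 0 = 0
  · have hb2 : (b / N) ^ 2 = q := by
      rw [hc] at hid; field_simp; linarith
    have hne : b / N + η * h * w 0 ≠ 0 := by
      intro h0
      have h1 : (b / N) ^ 2 = (η * h * w 0) ^ 2 := by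
        rw [show b / N = -(η * h * w 0) by linarith]; ring
      have h2 : q ≤ η ^ 2 * q := by rwa [← h1, hb2] at hlin
      have h3 : η ^ 2 < 1 := by nlinarith
      have h4 := mul_lt_mul_of_pos_right h3 hqpos
      linarith
    positivity
  · positivity

theorem torusRanders_strongly_convex {h η : ℝ} (hh : h ≠ 0) (hη : 0 ≤ η) (hη1 : η < 1) (x : T2)
    {v w : Plane} (hv : v ≠ 0) (hw : w ≠ 0) :
    0 < fderiv ℝ (fderiv ℝ fun u : Plane => torusRanders h η x u ^ 2) v w w := by
  have hcd : ContDiffAt ℝ 2 (fun u : Plane => torusRanders h η x u ^ 2) v :=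
    ((contDiffAt_torusRanders hh η (y := fun _ => x) contDiff_id hv).pow 2).of_le
      (WithTop.coe_le_coe.2 le_top)
  have hdd : DifferentiableAt ℝ (fderiv ℝ fun u : Plane => torusRanders h η x u ^ 2) v :=
    (hcd.fderiv_right (m := 1) (by norm_num [one_add_one_eq_two])).differentiableAt one_ne_zero
  have hline : HasDerivAt (fun t : ℝ => v + t • w) w 0 := by
    simpa using ((hasDerivAt_id' (0 : ℝ)).smul_const w).const_add v
  have hd1 : HasDerivAt (fun t : ℝ => fderiv ℝ (fun u : Plane => torusRanders h η x u ^ 2)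
      (v + t • w) w) (fderiv ℝ (fderiv ℝ fun u : Plane => torusRanders h η x u ^ 2) v w w) 0 :=
    hasDerivAt_fderiv_add_smul hdd w
  have hne : ∀ᶠ t : ℝ in nhds 0, v + t • w ≠ 0 := by
    refine hline.continuousAt.eventually_ne ?_
    simpa using hv
  -- The formula for dF fails at the zero vector, so the two sides agree only for t near 0.
  have heq : (fun t : ℝ => fderiv ℝ (fun u : Plane => torusRanders h η x u ^ 2) (v + t • w) w)
      =ᶠ[nhds 0] fun t : ℝ => 2 * torusRanders h η x (v + t • w) * covec h η (v + t • w) w := by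
    filter_upwards [hne] with t ht
    rw [((hasFDerivAt_torusRanders hh η x ht).pow 2).fderiv]
    simp
  set N := gnorm h v with hN
  have hNpos : 0 < N := gnorm_pos hh hv
  set b := h ^ 2 * v 0 * w 0 + h⁻¹ ^ 2 * v 1 * w 1 with hb
  have hF : HasDerivAt (fun t : ℝ => torusRanders h η x (v + t • w)) (b / N + η * h * w 0) 0 := by
    have h1 : HasFDerivAt (torusRanders h η x) (covec h η v) (v + (0 : ℝ) • w) := by
      simpa using hasFDerivAt_torusRanders hh η x hv
    refine (h1.comp_hasDerivAt (0 : ℝ) hline).congr_deriv ?_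
    rw [covec_apply, hb, ← hN]
    ring
  -- The g₀-norm is F minus a linear form, so its derivative follows from `hF`.
  have hG : HasDerivAt (fun t : ℝ => gnorm h (v + t • w)) (b / N) 0 := by
    have h1 : HasDerivAt (fun t : ℝ => (v + t • w) 0) (w 0) 0 := (hasDerivAt_pi.1 hline) 0
    have h2 := hF.sub (h1.const_mul (η * h))
    refine (h2.congr_deriv (by ring)).congr_of_eventuallyEq (.of_forall fun t => ?_)
    simp [torusRanders_apply]
  have hC : HasDerivAt (fun t : ℝ => covec h η (v + t • w) w)
      ((h ^ 2 * w 0 ^ 2 + h⁻¹ ^ 2 * w 1 ^ 2) / N - b ^ 2 / N ^ 3) 0 := by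
    have h0 : HasDerivAt (fun t : ℝ => (v + t • w) 0) (w 0) 0 := (hasDerivAt_pi.1 hline) 0
    have h1 : HasDerivAt (fun t : ℝ => (v + t • w) 1) (w 1) 0 := (hasDerivAt_pi.1 hline) 1
    have hne0 : gnorm h (v + (0 : ℝ) • w) ≠ 0 := by simpa using hNpos.ne'
    have h2 := ((((h0.const_mul (h ^ 2)).div hG hne0).add_const (η * h)).mul_const (w 0)).add
      (((h1.const_mul (h⁻¹ ^ 2)).div hG hne0).mul_const (w 1))
    refine (h2.congr_deriv ?_).congr_of_eventuallyEq (.of_forall fun t => ?_)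
    · simp only [zero_smul, add_zero, ← hN]
      rw [hb]
      field_simp
      ring
    · simp [covec_apply]
  have hd2 := (((hF.const_mul 2).mul hC).congr_of_eventuallyEq heq).unique hd1
  rw [← hd2]
  simp only [zero_smul, add_zero]
  have e1 : covec h η v w = b / N + η * h * w 0 := by
    rw [covec_apply, hb, ← hN]; ring
  rw [e1]
  have := hessian_pos hh hη hη1 hw (torusRanders_pos hh hη hη1 x hv) hNpos (gnorm_sq h v)
  rw [← hb] at this
  calc _ < 2 * _ := mul_pos two_pos this
    _ = _ := by ring

theorem isFinslerMetric_torusRanders {h η : ℝ} (hh : h ≠ 0) (hη : 0 ≤ η) (hη1 : η < 1) :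
    IsFinslerMetric (torusRanders h η) where
  continuous := by
    simp only [torusRanders_apply, gnorm]
    fun_prop
  smooth := fun q hq => (contDiffAt_torusRanders hh η (y := fun q : Plane × Plane => proj q.1)
    contDiff_snd hq).contDiffWithinAt
  homogeneous := by
    intro x v c hc
    simp only [torusRanders_apply, gnorm, Pi.smul_apply, smul_eq_mul]
    rw [show h ^ 2 * (c * v 0) ^ 2 + h⁻¹ ^ 2 * (c * v 1) ^ 2 =
      c ^ 2 * (h ^ 2 * v 0 ^ 2 + h⁻¹ ^ 2 * v 1 ^ 2) by ring, Real.sqrt_mul (sq_nonneg c),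
      Real.sqrt_sq hc.le]
    ring
  nonneg := fun x v =>
    (mul_nonneg (by linarith) (Real.sqrt_nonneg _)).trans (mul_gnorm_le_torusRanders hη x v)
  eq_zero_iff := by
    refine fun x v => ⟨fun h0 => ?_, fun h0 => ?_⟩
    · by_contra hv
      exact (torusRanders_pos hh hη hη1 x hv).ne' h0
    · simp [torusRanders_apply, gnorm, h0]
  strongly_convex := fun x _ _ hv hw => torusRanders_strongly_convex hh hη hη1 x hv hw

/-! ### The Hilbert form, its Reeb field and the angle form -/

theorem dir_ne_zero (θ : ℝ) : dir θ ≠ 0 := by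
  intro h0
  have h1 : Real.cos θ = 0 := by simpa [dir] using congrFun h0 0
  have h2 : Real.sin θ = 0 := by simpa [dir] using congrFun h0 1
  have := Real.sin_sq_add_cos_sq θ
  simp [h1, h2] at this

/-- The `g₀`-norm of the direction `(cos θ, sin θ)`. -/
def dirNorm (h θ : ℝ) : ℝ := gnorm h (dir θ)

theorem dirNorm_pos {h : ℝ} (hh : h ≠ 0) (θ : ℝ) : 0 < dirNorm h θ := gnorm_pos hh (dir_ne_zero θ)

theorem dirNorm_sq (h θ : ℝ) :
    dirNorm h θ ^ 2 = h ^ 2 * Real.cos θ ^ 2 + h⁻¹ ^ 2 * Real.sin θ ^ 2 := by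
  simp only [dirNorm, gnorm_sq]
  simp [dir]

theorem hasDerivAt_dirNorm {h : ℝ} (hh : h ≠ 0) (θ : ℝ) :
    HasDerivAt (dirNorm h)
      ((h⁻¹ ^ 2 - h ^ 2) * Real.sin θ * Real.cos θ / dirNorm h θ) θ := by
  have h0 : HasDerivAt (fun θ => h ^ 2 * Real.cos θ ^ 2 + h⁻¹ ^ 2 * Real.sin θ ^ 2)
      (2 * ((h⁻¹ ^ 2 - h ^ 2) * Real.sin θ * Real.cos θ)) θ :=
    ((((Real.hasDerivAt_cos θ).pow 2).const_mul (h ^ 2)).add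
      (((Real.hasDerivAt_sin θ).pow 2).const_mul (h⁻¹ ^ 2))).congr_deriv (by norm_num; ring)
  have hfun : dirNorm h = fun θ => √(h ^ 2 * Real.cos θ ^ 2 + h⁻¹ ^ 2 * Real.sin θ ^ 2) := by
    funext θ
    simp [dirNorm, gnorm, dir]
  have hpos := dirNorm_pos hh θ
  have h1 := h0.sqrt (by rw [← dirNorm_sq]; positivity)
  rw [← congrFun hfun θ] at h1
  rw [hfun] at h1 ⊢
  exact h1.congr_deriv (mul_div_mul_left _ _ two_ne_zero)

/-- With the next lemma, ∂A/∂θ = (-sin θ dx + cos θ dy) / N³, where N = `dirNorm h θ`. It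
annihilates the direction itself, and the factor det g₀ is one. The closed form η h dx drops out. -/
theorem hasDerivAt_cos_div_dirNorm {h : ℝ} (hh : h ≠ 0) (η θ : ℝ) :
    HasDerivAt (fun θ => h ^ 2 * Real.cos θ / dirNorm h θ + η * h)
      (-Real.sin θ / dirNorm h θ ^ 3) θ := by
  have hpos := dirNorm_pos hh θ
  refine ((((Real.hasDerivAt_cos θ).const_mul (h ^ 2)).div (hasDerivAt_dirNorm hh θ)
    hpos.ne').add_const (η * h)).congr_deriv ?_
  have hs := dirNorm_sq h θ
  field_simp at hs ⊢
  linear_combination (-Real.sin θ) * hs - Real.sin θ * Real.sin_sq_add_cos_sq θ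

theorem hasDerivAt_sin_div_dirNorm {h : ℝ} (hh : h ≠ 0) (θ : ℝ) :
    HasDerivAt (fun θ => h⁻¹ ^ 2 * Real.sin θ / dirNorm h θ)
      (Real.cos θ / dirNorm h θ ^ 3) θ := by
  have hpos := dirNorm_pos hh θ
  refine (((Real.hasDerivAt_sin θ).const_mul (h⁻¹ ^ 2)).div (hasDerivAt_dirNorm hh θ)
    hpos.ne').congr_deriv ?_
  have hs := dirNorm_sq h θ
  field_simp at hs ⊢
  linear_combination Real.cos θ * hs + Real.cos θ * h ^ 4 * Real.sin_sq_add_cos_sq θ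

/-- The coordinate `1`-forms `dx` and `dy`. -/
def coordForm (i : Fin 2) : HPlane →L[ℝ] ℝ :=
  (ContinuousLinearMap.proj i).comp (ContinuousLinearMap.fst ℝ Plane ℝ)

theorem coordForm_apply (i : Fin 2) (u : HPlane) : coordForm i u = u.1 i := rfl

theorem hilbertForm_torusRanders {h : ℝ} (hh : h ≠ 0) (η : ℝ) (q : HPlane) :
    hilbertForm (torusRanders h η) q =
      (h ^ 2 * Real.cos q.2 / dirNorm h q.2 + η * h) • coordForm 0 +
        (h⁻¹ ^ 2 * Real.sin q.2 / dirNorm h q.2) • coordForm 1 := by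
  rw [hilbertForm, (hasFDerivAt_torusRanders hh η (proj q.1) (dir_ne_zero q.2)).fderiv]
  ext u <;> simp [covec_apply, coordForm_apply, dir, dirNorm]

theorem dHilbertForm_torusRanders {h : ℝ} (hh : h ≠ 0) (η : ℝ) (q u v : HPlane) :
    dHilbertForm (torusRanders h η) q ![u, v] =
      (u.2 * (-Real.sin q.2 * v.1 0 + Real.cos q.2 * v.1 1) -
        v.2 * (-Real.sin q.2 * u.1 0 + Real.cos q.2 * u.1 1)) / dirNorm h q.2 ^ 3 := by
  have hA : ∀ w : HPlane, HasFDerivAt (fun q => hilbertForm (torusRanders h η) q w)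
      (((-Real.sin q.2 / dirNorm h q.2 ^ 3) * w.1 0 + (Real.cos q.2 / dirNorm h q.2 ^ 3) * w.1 1) •
        ContinuousLinearMap.snd ℝ Plane ℝ) q := by
    intro w
    have h1 := (((hasDerivAt_cos_div_dirNorm hh η q.2).mul_const (w.1 0)).add
      ((hasDerivAt_sin_div_dirNorm hh q.2).mul_const (w.1 1))).comp_hasFDerivAt q
      (hasFDerivAt_snd (𝕜 := ℝ) (p := q))
    refine h1.congr_of_eventuallyEq (.of_forall fun q => ?_)
    simp [hilbertForm_torusRanders hh, coordForm_apply]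
  have hω : (fun q => ContinuousAlternatingMap.ofSubsingleton ℝ HPlane ℝ (0 : Fin 1)
      (hilbertForm (torusRanders h η) q)) = fun q =>
      (h ^ 2 * Real.cos q.2 / dirNorm h q.2 + η * h) •
        ContinuousAlternatingMap.ofSubsingleton ℝ HPlane ℝ (0 : Fin 1) (coordForm 0) +
      (h⁻¹ ^ 2 * Real.sin q.2 / dirNorm h q.2) •
        ContinuousAlternatingMap.ofSubsingleton ℝ HPlane ℝ (0 : Fin 1) (coordForm 1) := by
    funext q
    rw [hilbertForm_torusRanders hh]
    ext m
    simp
  have hd : DifferentiableAt ℝ (fun q => ContinuousAlternatingMap.ofSubsingleton ℝ HPlane ℝ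
      (0 : Fin 1) (hilbertForm (torusRanders h η) q)) q := by
    rw [hω]
    have h1 : DifferentiableAt ℝ
        (fun q : HPlane => h ^ 2 * Real.cos q.2 / dirNorm h q.2 + η * h) q :=
      (hasDerivAt_cos_div_dirNorm hh η q.2).differentiableAt.comp q differentiableAt_snd
    have h2 : DifferentiableAt ℝ (fun q : HPlane => h⁻¹ ^ 2 * Real.sin q.2 / dirNorm h q.2) q :=
      (hasDerivAt_sin_div_dirNorm hh q.2).differentiableAt.comp q differentiableAt_snd
    exact (h1.smul_const _).add (h2.smul_const _)
  -- Convention: dA(u, v) = ∂ᵤ(A(v)) - ∂ᵥ(A(u)) for constant u and v, without a factor 1/2.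
  refine (extDeriv_apply hd _).trans ((Fin.sum_univ_two _).trans ?_)
  change (-1 : ℤ) ^ 0 • fderiv ℝ (fun q => hilbertForm (torusRanders h η) q v) q u +
    (-1 : ℤ) ^ 1 • fderiv ℝ (fun q => hilbertForm (torusRanders h η) q u) q v = _
  simp only [(hA u).fderiv, (hA v).fderiv]
  simp
  ring

theorem torusRanders_dir (h η : ℝ) (x : T2) (θ : ℝ) :
    torusRanders h η x (dir θ) = dirNorm h θ + η * h * Real.cos θ := by
  rw [torusRanders_apply]; simp [dirNorm, dir]

theorem dirNorm_add_pos {h η : ℝ} (hh : h ≠ 0) (hη : 0 ≤ η) (hη1 : η < 1) (θ : ℝ) :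
    0 < dirNorm h θ + η * h * Real.cos θ := by
  rw [← torusRanders_dir h η 0]
  exact torusRanders_pos hh hη hη1 0 (dir_ne_zero θ)

theorem contactVolume_torusRanders {h : ℝ} (hh : h ≠ 0) (η : ℝ) (p : Plane) (θ : ℝ) :
    contactVolume (torusRanders h η) (p, θ) eθ ex ey =
      -((dirNorm h θ + η * h * Real.cos θ) / dirNorm h θ ^ 3) := by
  have hpos := dirNorm_pos hh θ
  simp only [contactVolume, dHilbertForm_torusRanders hh, hilbertForm_torusRanders hh]
  simp [coordForm_apply, eθ, ex, ey]
  have hs := dirNorm_sq h θ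
  field_simp at hs ⊢
  linear_combination hs

/-- Because `reeb` is an arbitrary choice, existence must be shown first and then uniqueness.
Contracting dA with the horizontal normal to the direction kills the θ-component, contracting with
∂/∂θ makes the base component parallel to the direction, and A(X) = 1 fixes its length as 1 / F. -/
theorem reeb_torusRanders {h η : ℝ} (hh : h ≠ 0) (hη : 0 ≤ η) (hη1 : η < 1) (q : HPlane) :
    reeb (torusRanders h η) q =
      ((dirNorm h q.2 + η * h * Real.cos q.2)⁻¹ • dir q.2, 0) := by
  have hpos := dirNorm_pos hh q.2
  have hF := dirNorm_add_pos hh hη hη1 q.2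
  have hs := dirNorm_sq h q.2
  have hcs := Real.sin_sq_add_cos_sq q.2
  have hA : ∀ X : HPlane, hilbertForm (torusRanders h η) q X =
      (h ^ 2 * Real.cos q.2 / dirNorm h q.2 + η * h) * X.1 0 +
        h⁻¹ ^ 2 * Real.sin q.2 / dirNorm h q.2 * X.1 1 := fun X => by
    simp [hilbertForm_torusRanders hh, coordForm_apply]
  have hdir : (h ^ 2 * Real.cos q.2 / dirNorm h q.2 + η * h) * Real.cos q.2 +
      h⁻¹ ^ 2 * Real.sin q.2 / dirNorm h q.2 * Real.sin q.2 =
        dirNorm h q.2 + η * h * Real.cos q.2 := by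
    field_simp at hs ⊢
    linear_combination -hs
  have hex : ∃ X : HPlane, hilbertForm (torusRanders h η) q X = 1 ∧
      ∀ w, dHilbertForm (torusRanders h η) q ![X, w] = 0 := by
    refine ⟨((dirNorm h q.2 + η * h * Real.cos q.2)⁻¹ • dir q.2, 0), ?_, fun w => ?_⟩
    · rw [hA]
      simp only [dir, Pi.smul_apply, smul_eq_mul, Matrix.cons_val_zero, Matrix.cons_val_one]
      rw [← mul_inv_cancel₀ hF.ne']
      nth_rewrite 3 [← hdir]
      ring
    · rw [dHilbertForm_torusRanders hh]
      simp only [dir, Pi.smul_apply, smul_eq_mul, Matrix.cons_val_zero, Matrix.cons_val_one]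
      ring
  obtain ⟨h1, h2⟩ := Classical.epsilon_spec hex
  change hilbertForm (torusRanders h η) q (reeb (torusRanders h η) q) = 1 at h1
  change ∀ w, dHilbertForm (torusRanders h η) q ![reeb (torusRanders h η) q, w] = 0 at h2
  generalize reeb (torusRanders h η) q = X at h1 h2
  rw [hA] at h1
  simp only [dHilbertForm_torusRanders hh, div_eq_zero_iff, pow_eq_zero_iff three_ne_zero,
    hpos.ne', or_false] at h2
  have k1 := h2 (![-Real.sin q.2, Real.cos q.2], 0)
  have k2 := h2 (0, 1)
  simp at k1 k2
  have hX2 : X.2 = 0 := by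
    rcases k1 with k | k
    · exact k
    · nlinarith
  set c := Real.cos q.2 * X.1 0 + Real.sin q.2 * X.1 1 with hc
  have hX0 : X.1 0 = c * Real.cos q.2 := by
    rw [hc]; linear_combination (-X.1 0) * hcs + Real.sin q.2 * k2
  have hX1 : X.1 1 = c * Real.sin q.2 := by
    rw [hc]; linear_combination (-X.1 1) * hcs - Real.cos q.2 * k2
  have hcF : c = (dirNorm h q.2 + η * h * Real.cos q.2)⁻¹ := by
    refine eq_inv_of_mul_eq_one_left ?_
    rw [← h1, hX0, hX1, ← hdir]
    ring
  refine Prod.ext ?_ hX2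
  ext i
  fin_cases i
  · simpa [dir, ← hcF] using hX0
  · simpa [dir, ← hcF] using hX1

open intervalIntegral

/-! ### The `g₀`-angle and the volume -/

/-- The angle of the direction `(cos θ, sin θ)` in a `g₀`-orthonormal frame. -/
def isoAngle (h θ : ℝ) : ℝ :=
  θ + Real.arctan ((h⁻¹ ^ 2 - 1) * (Real.sin θ * Real.cos θ) /
    (Real.cos θ ^ 2 + h⁻¹ ^ 2 * Real.sin θ ^ 2))

theorem isoAngle_denom_pos {h : ℝ} (hh : h ≠ 0) (θ : ℝ) :
    0 < Real.cos θ ^ 2 + h⁻¹ ^ 2 * Real.sin θ ^ 2 := by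
  have h1 : 0 < h⁻¹ ^ 2 := by positivity
  rcases eq_or_ne (Real.cos θ) 0 with hc | hc
  · have : Real.sin θ ≠ 0 := fun hs => by simpa [hs, hc] using Real.sin_sq_add_cos_sq θ
    positivity
  · positivity

/-- The arctangent in `isoAngle` is the oriented angle from (cos θ, sin θ) to (h cos θ, h⁻¹ sin θ):
its argument is cross product over inner product. The inner product is positive, so no branch change
occurs. The identity is 1 + tan² = 1 / cos² for that angle. -/
theorem one_add_isoAngle_arg_sq {h : ℝ} (hh : h ≠ 0) (θ : ℝ) :
    1 + ((h⁻¹ ^ 2 - 1) * (Real.sin θ * Real.cos θ) /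
      (Real.cos θ ^ 2 + h⁻¹ ^ 2 * Real.sin θ ^ 2)) ^ 2 =
    (dirNorm h θ * h⁻¹ / (Real.cos θ ^ 2 + h⁻¹ ^ 2 * Real.sin θ ^ 2)) ^ 2 := by
  have hD := isoAngle_denom_pos hh θ
  have hs := dirNorm_sq h θ
  have ht := Real.sin_sq_add_cos_sq θ
  rw [div_pow _ _ 2, div_pow _ _ 2, mul_pow (dirNorm h θ), hs]
  rw [eq_div_iff (by positivity), add_mul, div_mul_cancel₀ _ (by positivity)]
  have hk : h⁻¹ ^ 2 * h ^ 2 = 1 := by field_simp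
  generalize h⁻¹ ^ 2 = k at *
  generalize Real.sin θ = s at *
  generalize Real.cos θ = c at *
  linear_combination (c ^ 2 + k ^ 2 * s ^ 2) * ht - c ^ 2 * hk

/-- A linear map of determinant one preserves r² dφ, so dφ = dθ / N². -/
theorem hasDerivAt_isoAngle {h : ℝ} (hh : h ≠ 0) (θ : ℝ) :
    HasDerivAt (isoAngle h) (dirNorm h θ ^ 2)⁻¹ θ := by
  have hD := isoAngle_denom_pos hh θ
  have hN := dirNorm_pos hh θ
  have h1 : HasDerivAt (fun θ => Real.cos θ ^ 2 + h⁻¹ ^ 2 * Real.sin θ ^ 2)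
      (2 * (h⁻¹ ^ 2 - 1) * (Real.sin θ * Real.cos θ)) θ :=
    (((Real.hasDerivAt_cos θ).pow 2).add
      (((Real.hasDerivAt_sin θ).pow 2).const_mul (h⁻¹ ^ 2))).congr_deriv (by norm_num; ring)
  have h2 := (hasDerivAt_id' θ).add (((((Real.hasDerivAt_sin θ).mul
    (Real.hasDerivAt_cos θ)).const_mul (h⁻¹ ^ 2 - 1)).div h1 hD.ne').arctan)
  refine h2.congr_deriv ?_
  have hs := dirNorm_sq h θ
  have ht := Real.sin_sq_add_cos_sq θ
  have hk : h⁻¹ ^ 2 * h ^ 2 = 1 := by field_simp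
  have hk0 : h⁻¹ ^ 2 ≠ 0 := by positivity
  simp only [Pi.mul_apply, Pi.div_apply]
  rw [one_add_isoAngle_arg_sq hh, div_pow _ _ 2, mul_pow (dirNorm h θ)]
  generalize h⁻¹ ^ 2 = k at *
  generalize Real.sin θ = s at *
  generalize Real.cos θ = c at *
  have hE : (k - 1) * (c * c + s * -s) * (c ^ 2 + k * s ^ 2) -
      (k - 1) * (s * c) * (2 * (k - 1) * (s * c)) = k - dirNorm h θ ^ 2 * k := by
    rw [hs]
    linear_combination (c ^ 2 - k * s ^ 2) * (k - 1) * ht + c ^ 2 * hk + k * ht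
  rw [hE]
  field_simp
  ring

theorem cos_isoAngle {h : ℝ} (hh : 0 < h) (θ : ℝ) :
    Real.cos (isoAngle h θ) = h * Real.cos θ / dirNorm h θ := by
  have hD := isoAngle_denom_pos hh.ne' θ
  have hN := dirNorm_pos hh.ne' θ
  rw [isoAngle, Real.cos_add, Real.cos_arctan, Real.sin_arctan, one_add_isoAngle_arg_sq hh.ne',
    Real.sqrt_sq (by positivity)]
  generalize hDd : Real.cos θ ^ 2 + h⁻¹ ^ 2 * Real.sin θ ^ 2 = D at *
  have ht := Real.sin_sq_add_cos_sq θ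
  field_simp at hDd ⊢
  linear_combination (-Real.cos θ) * hDd + h ^ 2 * Real.cos θ * ht

theorem sin_isoAngle {h : ℝ} (hh : 0 < h) (θ : ℝ) :
    Real.sin (isoAngle h θ) = h⁻¹ * Real.sin θ / dirNorm h θ := by
  have hD := isoAngle_denom_pos hh.ne' θ
  have hN := dirNorm_pos hh.ne' θ
  rw [isoAngle, Real.sin_add, Real.cos_arctan, Real.sin_arctan, one_add_isoAngle_arg_sq hh.ne',
    Real.sqrt_sq (by positivity)]
  generalize hDd : Real.cos θ ^ 2 + h⁻¹ ^ 2 * Real.sin θ ^ 2 = D at *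
  have ht := Real.sin_sq_add_cos_sq θ
  field_simp at hDd ⊢
  linear_combination (-Real.sin θ) * hDd + Real.sin θ * ht

theorem continuous_dirNorm {h : ℝ} (hh : h ≠ 0) : Continuous (dirNorm h) :=
  continuous_iff_continuousAt.2 fun θ => (hasDerivAt_dirNorm hh θ).continuousAt

theorem integral_comp_isoAngle {h : ℝ} (hh : h ≠ 0) {G : ℝ → ℝ} (hG : Continuous G) :
    ∫ θ in (0 : ℝ)..(2 * Real.pi), G (isoAngle h θ) * (dirNorm h θ ^ 2)⁻¹ =
      ∫ φ in (0 : ℝ)..(2 * Real.pi), G φ := by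
  have h1 := integral_comp_mul_deriv (a := 0) (b := 2 * Real.pi)
    (fun θ _ => hasDerivAt_isoAngle hh θ) (((continuous_dirNorm hh).pow 2).inv₀
      fun θ => pow_ne_zero 2 (dirNorm_pos hh θ).ne').continuousOn hG
  simpa [isoAngle] using h1

/-- The sign reflects the orientation (θ, x, y); it cancels in the angle form and disappears in the
total volume. -/
theorem volumeForm_torusRanders {h : ℝ} (hh : 0 < h) (η : ℝ) (p : Plane) :
    volumeForm (torusRanders h η) p = -1 := by
  have h1 : ∀ θ, contactVolume (torusRanders h η) (p, θ) eθ ex ey =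
      (fun φ => -(1 + η * Real.cos φ)) (isoAngle h θ) * (dirNorm h θ ^ 2)⁻¹ := by
    intro θ
    have hN := dirNorm_pos hh.ne' θ
    simp only [contactVolume_torusRanders hh.ne', cos_isoAngle hh]
    field_simp
  have h2 := integral_comp_isoAngle hh.ne' (G := fun φ => -(1 + η * Real.cos φ)) (by fun_prop)
  simp only [volumeForm, h1]
  rw [h2, integral_neg, integral_add (by simp)
    (Continuous.intervalIntegrable (by fun_prop) _ _), integral_const_mul, integral_cos]
  have := Real.pi_ne_zero
  simp
  field_simp

theorem totalVolume_torusRanders {h : ℝ} (hh : 0 < h) (η : ℝ) :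
    totalVolume (torusRanders h η) = 1 := by
  simp only [totalVolume, volumeForm_torusRanders hh]
  simp [MeasureTheory.Measure.real, Real.volume_Icc_pi]

/-! ### Trigonometric integrals -/

section TrigIntegrals

variable {η : ℝ}

theorem one_add_mul_cos_pos (hη : 0 ≤ η) (hη1 : η < 1) (φ : ℝ) : 0 < 1 + η * Real.cos φ := by
  nlinarith [Real.neg_one_le_cos φ]

theorem continuous_div_one_add_mul_cos (hη : 0 ≤ η) (hη1 : η < 1) {G : ℝ → ℝ}
    (hG : Continuous G) : Continuous fun φ => G φ / (1 + η * Real.cos φ) :=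
  hG.div (by fun_prop) fun φ => (one_add_mul_cos_pos hη hη1 φ).ne'

theorem integral_inv_one_add_mul_cos (hη : 0 ≤ η) (hη1 : η < 1) :
    ∫ φ in (0 : ℝ)..(2 * Real.pi), 1 / (1 + η * Real.cos φ) = 2 * Real.pi / √(1 - η ^ 2) := by
  have hpos : 0 < 1 - η ^ 2 := by nlinarith
  have hs2 : √(1 - η ^ 2) ^ 2 = 1 - η ^ 2 := Real.sq_sqrt hpos.le
  have hs : 0 < √(1 - η ^ 2) := Real.sqrt_pos.2 hpos
  generalize √(1 - η ^ 2) = s at *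
  -- Chosen so that η = 2β / (1 + β²), which turns the integrand into a multiple of a Poisson
  -- kernel. The primitive below is φ - 2 arg(1 + β e^{iφ}), divided by s; as β < 1 it is smooth on
  -- the whole circle, unlike the primitive in tan(φ/2).
  set β := η / (1 + s) with hβ
  have hβ0 : 0 ≤ β := by positivity
  have hβ1 : β < 1 := by rw [hβ, div_lt_one (by positivity)]; linarith
  have hβη : β * (1 + s) = η := by rw [hβ]; field_simp
  have hd : ∀ φ : ℝ, HasDerivAt
      (fun φ => (φ - 2 * Real.arctan (β * Real.sin φ / (1 + β * Real.cos φ))) / s)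
      (1 / (1 + η * Real.cos φ)) φ := by
    intro φ
    have hD := one_add_mul_cos_pos hβ0 hβ1 φ
    have hE := one_add_mul_cos_pos hη hη1 φ
    have h1 : HasDerivAt (fun φ => 1 + β * Real.cos φ) (β * -Real.sin φ) φ :=
      ((Real.hasDerivAt_cos φ).const_mul β).const_add 1
    refine (((hasDerivAt_id' φ).sub ((((Real.hasDerivAt_sin φ).const_mul β).div h1
      hD.ne').arctan.const_mul 2)).div_const s).congr_deriv ?_
    have ht := Real.sin_sq_add_cos_sq φ
    simp only [Pi.div_apply]
    have hq : 1 + (β * Real.sin φ / (1 + β * Real.cos φ)) ^ 2 =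
        (1 + 2 * β * Real.cos φ + β ^ 2) / (1 + β * Real.cos φ) ^ 2 := by
      field_simp
      linear_combination β ^ 2 * ht
    have hq0 : 0 < 1 + 2 * β * Real.cos φ + β ^ 2 := by
      have : 0 < (1 + 2 * β * Real.cos φ + β ^ 2) / (1 + β * Real.cos φ) ^ 2 := by
        rw [← hq]; positivity
      exact (div_pos_iff_of_pos_right (by positivity)).1 this
    rw [hq]
    have hn : β * Real.cos φ * (1 + β * Real.cos φ) - β * Real.sin φ * (β * -Real.sin φ) =
        β * (Real.cos φ + β) := by linear_combination β ^ 2 * ht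
    rw [hn]
    have hk : (1 - β ^ 2) * (1 + η * Real.cos φ) = s * (1 + 2 * β * Real.cos φ + β ^ 2) := by
      have hb2 : β ^ 2 * (1 + s) = 1 - s := by
        have : (1 + s) * (β ^ 2 * (1 + s)) = (1 + s) * (1 - s) := by
          linear_combination (β * (1 + s) + η) * hβη + hs2
        exact mul_left_cancel₀ (by positivity) this
      refine mul_left_cancel₀ (a := 1 + s) (by positivity) ?_
      linear_combination (-(1 + η * Real.cos φ) - s) * hb2 - 2 * s * Real.cos φ * hβη
    have hx : 1 - 2 * (1 / ((1 + 2 * β * Real.cos φ + β ^ 2) / (1 + β * Real.cos φ) ^ 2) *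
        (β * (Real.cos φ + β) / (1 + β * Real.cos φ) ^ 2)) =
        (1 - β ^ 2) / (1 + 2 * β * Real.cos φ + β ^ 2) := by
      field_simp
      ring
    rw [hx, div_div, div_eq_div_iff (by positivity) hE.ne']
    linear_combination hk
  rw [integral_eq_sub_of_hasDerivAt (fun φ _ => hd φ)
    ((continuous_div_one_add_mul_cos hη hη1 continuous_const).intervalIntegrable _ _)]
  simp

theorem intervalIntegrable_div_one_add_mul_cos (hη : 0 ≤ η) (hη1 : η < 1) {G : ℝ → ℝ}
    (hG : Continuous G) : IntervalIntegrable (fun φ => G φ / (1 + η * Real.cos φ))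
      MeasureTheory.volume 0 (2 * Real.pi) :=
  (continuous_div_one_add_mul_cos hη hη1 hG).intervalIntegrable _ _

theorem integral_cos_sq_div_one_add_mul_cos (hη : 0 < η) (hη1 : η < 1) :
    ∫ φ in (0 : ℝ)..(2 * Real.pi), Real.cos φ ^ 2 / (1 + η * Real.cos φ) =
      2 * Real.pi / (√(1 - η ^ 2) * (1 + √(1 - η ^ 2))) := by
  -- Division of cos² by 1 + η cos with remainder.
  have h1 : ∀ φ, Real.cos φ ^ 2 / (1 + η * Real.cos φ) =
      η⁻¹ * Real.cos φ - (η ^ 2)⁻¹ + (η ^ 2)⁻¹ * (1 / (1 + η * Real.cos φ)) := by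
    intro φ
    have := (one_add_mul_cos_pos hη.le hη1 φ).ne'
    rw [div_eq_iff this, add_mul, mul_assoc (η ^ 2)⁻¹, one_div_mul_cancel this]
    field_simp
    ring
  simp only [h1]
  rw [integral_add (Continuous.intervalIntegrable (by fun_prop) _ _)
    ((intervalIntegrable_div_one_add_mul_cos hη.le hη1 continuous_const).const_mul _),
    integral_sub (Continuous.intervalIntegrable (by fun_prop) _ _)
      (Continuous.intervalIntegrable (by fun_prop) _ _), integral_const_mul, integral_const_mul,
    integral_inv_one_add_mul_cos hη.le hη1, integral_cos, integral_const]
  have hpos : 0 < 1 - η ^ 2 := by nlinarith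
  have hs2 : √(1 - η ^ 2) ^ 2 = 1 - η ^ 2 := Real.sq_sqrt hpos.le
  have hs : 0 < √(1 - η ^ 2) := Real.sqrt_pos.2 hpos
  generalize √(1 - η ^ 2) = s at *
  have hη2 : η ^ 2 = (1 - s) * (1 + s) := by linear_combination hs2
  have hs1 : 1 - s ≠ 0 := by
    intro h0
    rw [h0, zero_mul] at hη2
    exact absurd hη2 (by positivity)
  rw [hη2]
  simp
  field_simp
  ring

theorem integral_sin_sq_div_one_add_mul_cos (hη : 0 < η) (hη1 : η < 1) :
    ∫ φ in (0 : ℝ)..(2 * Real.pi), Real.sin φ ^ 2 / (1 + η * Real.cos φ) =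
      2 * Real.pi / (1 + √(1 - η ^ 2)) := by
  have h1 : ∀ φ, Real.sin φ ^ 2 / (1 + η * Real.cos φ) =
      1 / (1 + η * Real.cos φ) - Real.cos φ ^ 2 / (1 + η * Real.cos φ) := by
    intro φ
    rw [Real.sin_sq, sub_div]
  simp only [h1]
  rw [integral_sub (intervalIntegrable_div_one_add_mul_cos hη.le hη1 continuous_const)
    (intervalIntegrable_div_one_add_mul_cos hη.le hη1 (by fun_prop)),
    integral_inv_one_add_mul_cos hη.le hη1, integral_cos_sq_div_one_add_mul_cos hη hη1]
  have hs : 0 < √(1 - η ^ 2) := Real.sqrt_pos.2 (by nlinarith)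
  field_simp
  ring

/-- The integrand has a 2π-periodic primitive; this removes the mixed derivative from the Laplacian.
-/
theorem integral_cos_mul_sin_div_one_add_mul_cos (hη : 0 < η) (hη1 : η < 1) :
    ∫ φ in (0 : ℝ)..(2 * Real.pi), Real.cos φ * Real.sin φ / (1 + η * Real.cos φ) = 0 := by
  have hd : ∀ φ : ℝ, HasDerivAt
      (fun φ => (η ^ 2)⁻¹ * Real.log (1 + η * Real.cos φ) - η⁻¹ * Real.cos φ)
      (Real.cos φ * Real.sin φ / (1 + η * Real.cos φ)) φ := by
    intro φ
    have hE := one_add_mul_cos_pos hη.le hη1 φ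
    refine ((((((Real.hasDerivAt_cos φ).const_mul η).const_add 1).log hE.ne').const_mul
      (η ^ 2)⁻¹).sub ((Real.hasDerivAt_cos φ).const_mul η⁻¹)).congr_deriv ?_
    field_simp
    ring
  rw [integral_eq_sub_of_hasDerivAt (fun φ _ => hd φ)
    (intervalIntegrable_div_one_add_mul_cos hη.le hη1 (by fun_prop))]
  simp

end TrigIntegrals

/-! ### The Finsler-Laplacian -/

theorem lieReeb_lieReeb_torusRanders {h η : ℝ} (hh : h ≠ 0) (hη : 0 ≤ η) (hη1 : η < 1)
    {f : T2 → ℝ} (hf : ContDiff ℝ 2 fun p => f (proj p)) (p : Plane) (θ : ℝ) :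
    lieReeb (torusRanders h η) (lieReeb (torusRanders h η) fun q => f (proj q.1)) (p, θ) =
      fderiv ℝ (fderiv ℝ fun p => f (proj p)) p
        ((dirNorm h θ + η * h * Real.cos θ)⁻¹ • dir θ)
        ((dirNorm h θ + η * h * Real.cos θ)⁻¹ • dir θ) := by
  have hf1 : Differentiable ℝ fun p => f (proj p) := hf.differentiable two_ne_zero
  have hf2 : Differentiable ℝ (fderiv ℝ fun p => f (proj p)) :=
    (hf.fderiv_right (m := 1) (by norm_num [one_add_one_eq_two])).differentiable one_ne_zero
  generalize hg : (fun p => f (proj p)) = g at hf1 hf2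
  have hW : Differentiable ℝ fun θ => (dirNorm h θ + η * h * Real.cos θ)⁻¹ • dir θ := by
    intro θ
    have h1 : DifferentiableAt ℝ (fun θ => dirNorm h θ + η * h * Real.cos θ) θ :=
      (hasDerivAt_dirNorm hh θ).differentiableAt.add (by fun_prop)
    have h2 : DifferentiableAt ℝ dir θ := by
      rw [differentiableAt_pi]
      intro i
      fin_cases i
      · exact Real.differentiable_cos θ
      · exact Real.differentiable_sin θ
    exact (h1.inv (dirNorm_add_pos hh hη hη1 θ).ne').smul h2
  have e1 : (lieReeb (torusRanders h η) fun q => f (proj q.1)) =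
      fun q => fderiv ℝ g q.1 ((dirNorm h q.2 + η * h * Real.cos q.2)⁻¹ • dir q.2) := by
    funext q
    have h1 : HasFDerivAt (fun q : HPlane => f (proj q.1))
        ((fderiv ℝ g q.1).comp (ContinuousLinearMap.fst ℝ Plane ℝ)) q := by
      have h2 := (hf1 q.1).hasFDerivAt.comp q (hasFDerivAt_fst (𝕜 := ℝ) (p := q))
      rw [← hg] at h2 ⊢
      exact h2
    rw [lieReeb, h1.fderiv, reeb_torusRanders hh hη hη1]
    rfl
  have h3 := ((hf2 p).hasFDerivAt.comp (p, θ) (hasFDerivAt_fst (𝕜 := ℝ) (p := (p, θ)))).clm_apply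
    ((hW θ).hasFDerivAt.comp (p, θ) (hasFDerivAt_snd (𝕜 := ℝ) (p := (p, θ))))
  rw [e1, lieReeb, reeb_torusRanders hh hη hη1]
  -- The Reeb field has no θ-component, so the variation of the direction contributes nothing and
  -- only the Hessian of f remains.
  refine (DFunLike.congr_fun h3.fderiv _).trans ?_
  simp

theorem bilinear_plane (B : Plane →L[ℝ] Plane →L[ℝ] ℝ) (w : Plane) :
    B w w = w 0 ^ 2 * B (Pi.single 0 1) (Pi.single 0 1) +
      w 0 * w 1 * (B (Pi.single 0 1) (Pi.single 1 1) + B (Pi.single 1 1) (Pi.single 0 1)) +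
      w 1 ^ 2 * B (Pi.single 1 1) (Pi.single 1 1) := by
  have hw : w = w 0 • Pi.single 0 1 + w 1 • Pi.single 1 1 := by
    ext i; fin_cases i <;> simp
  conv_lhs => rw [hw]
  simp only [map_add, map_smul, add_apply, smul_apply, smul_eq_mul]
  ring

theorem partialDeriv_partialDeriv_proj {f : T2 → ℝ} (hf : ContDiff ℝ 2 fun p => f (proj p))
    (i : Fin 2) (p : Plane) :
    partialDeriv i (partialDeriv i f) (proj p) =
      fderiv ℝ (fderiv ℝ fun p => f (proj p)) p (Pi.single i 1) (Pi.single i 1) := by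
  have hd : ContDiff ℝ 1 fun p => partialDeriv i f (proj p) :=
    contDiff_partialDeriv hf (by norm_num [one_add_one_eq_two]) i
  have hf2 : Differentiable ℝ (fderiv ℝ fun p => f (proj p)) :=
    (hf.fderiv_right (m := 1) (by norm_num [one_add_one_eq_two])).differentiable one_ne_zero
  rw [partialDeriv_proj (hd.differentiable one_ne_zero)]
  simp only [partialDeriv_proj (hf.differentiable two_ne_zero)]
  rw [fderiv_clm_apply (hf2 p) (differentiableAt_const _)]
  simp

/-- The Finsler-Laplacian of `√g₀ + η h dx` has constant coefficients. -/
theorem laplacian_torusRanders {h η : ℝ} (hh : 0 < h) (hη : 0 < η) (hη1 : η < 1)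
    {f : T2 → ℝ} (hf : ContDiff ℝ 2 fun p => f (proj p)) (p : Plane) :
    laplacian (torusRanders h η) f p =
      2 / (h ^ 2 * (√(1 - η ^ 2) * (1 + √(1 - η ^ 2)))) *
        partialDeriv 0 (partialDeriv 0 f) (proj p) +
      2 * h ^ 2 / (1 + √(1 - η ^ 2)) * partialDeriv 1 (partialDeriv 1 f) (proj p) := by
  rw [partialDeriv_partialDeriv_proj hf, partialDeriv_partialDeriv_proj hf]
  simp only [laplacian, lieReeb_lieReeb_torusRanders hh.ne' hη.le hη1 hf, angleForm,
    volumeForm_torusRanders hh, contactVolume_torusRanders hh.ne']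
  generalize fderiv ℝ (fderiv ℝ fun p => f (proj p)) p = B
  set b₀ := B (Pi.single 0 1) (Pi.single 0 1)
  set b₁ := B (Pi.single 0 1) (Pi.single 1 1) + B (Pi.single 1 1) (Pi.single 0 1)
  set b₂ := B (Pi.single 1 1) (Pi.single 1 1)
  let G : ℝ → ℝ := fun φ => b₀ / h ^ 2 * (Real.cos φ ^ 2 / (1 + η * Real.cos φ)) +
    b₁ * (Real.cos φ * Real.sin φ / (1 + η * Real.cos φ)) +
    b₂ * h ^ 2 * (Real.sin φ ^ 2 / (1 + η * Real.cos φ))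
  have hc : ∀ {G : ℝ → ℝ}, Continuous G → Continuous fun φ => G φ / (1 + η * Real.cos φ) :=
    continuous_div_one_add_mul_cos hη.le hη1
  have h0 : Continuous fun φ => Real.cos φ ^ 2 / (1 + η * Real.cos φ) := hc (by fun_prop)
  have h1 : Continuous fun φ => Real.cos φ * Real.sin φ / (1 + η * Real.cos φ) :=
    hc (by fun_prop)
  have h2 : Continuous fun φ => Real.sin φ ^ 2 / (1 + η * Real.cos φ) := hc (by fun_prop)
  have hG : Continuous G := by fun_prop
  -- Two Reeb factors 1 / F against an angle form F / N³ leave 1 / (F N³). Substituting cos θ = N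
  -- cos φ / h, sin θ = h N sin φ and F = N (1 + η cos φ) leaves exactly the Jacobian N⁻².
  have hint : ∀ θ, B ((dirNorm h θ + η * h * Real.cos θ)⁻¹ • dir θ)
      ((dirNorm h θ + η * h * Real.cos θ)⁻¹ • dir θ) *
        (-((dirNorm h θ + η * h * Real.cos θ) / dirNorm h θ ^ 3) / -1) =
      G (isoAngle h θ) * (dirNorm h θ ^ 2)⁻¹ := by
    intro θ
    have hN := dirNorm_pos hh.ne' θ
    have hF := dirNorm_add_pos hh.ne' hη.le hη1 θ
    have hq : 1 + η * (h * Real.cos θ / dirNorm h θ) =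
        (dirNorm h θ + η * h * Real.cos θ) / dirNorm h θ := by
      field_simp
    rw [bilinear_plane B]
    simp only [G, cos_isoAngle hh, sin_isoAngle hh, hq]
    simp only [dir, Pi.smul_apply, smul_eq_mul, Matrix.cons_val_zero, Matrix.cons_val_one]
    generalize dirNorm h θ + η * h * Real.cos θ = F at *
    generalize dirNorm h θ = N at *
    field_simp
    ring
  simp only [hint]
  rw [integral_comp_isoAngle hh.ne' hG]
  simp only [G]
  rw [integral_add ((Continuous.intervalIntegrable (by fun_prop) _ _))
    (Continuous.intervalIntegrable (by fun_prop) _ _),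
    integral_add ((Continuous.intervalIntegrable (by fun_prop) _ _))
    (Continuous.intervalIntegrable (by fun_prop) _ _), integral_const_mul, integral_const_mul,
    integral_const_mul, integral_cos_sq_div_one_add_mul_cos hη hη1,
    integral_cos_mul_sin_div_one_add_mul_cos hη hη1, integral_sin_sq_div_one_add_mul_cos hη hη1]
  have hs : 0 < √(1 - η ^ 2) := Real.sqrt_pos.2 (by nlinarith)
  have := Real.pi_pos
  field_simp
  ring

/-! ### The spectrum -/

/-- The function `cos (2π xᵢ)`. -/
def cosCoord (i : Fin 2) (x : T2) : ℝ := (fourier 1 (x i)).re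

/-- The function `sin (2π xᵢ)`. -/
def sinCoord (i : Fin 2) (x : T2) : ℝ := (fourier 1 (x i)).im

theorem fourier_one_coe (t : ℝ) :
    fourier 1 (t : UnitAddCircle) = Complex.exp ((2 * Real.pi * t : ℝ) * Complex.I) := by
  rw [fourier_coe_apply]
  congr 1
  push_cast
  ring

theorem cosCoord_proj (i : Fin 2) (p : Plane) :
    cosCoord i (proj p) = Real.cos (2 * Real.pi * p i) := by
  rw [cosCoord, proj, fourier_one_coe, Complex.exp_ofReal_mul_I_re]

theorem sinCoord_proj (i : Fin 2) (p : Plane) :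
    sinCoord i (proj p) = Real.sin (2 * Real.pi * p i) := by
  rw [sinCoord, proj, fourier_one_coe, Complex.exp_ofReal_mul_I_im]

theorem contDiff_cosCoord (i : Fin 2) : ContDiff ℝ 2 fun p => cosCoord i (proj p) := by
  simp only [cosCoord_proj]
  fun_prop

theorem hasDerivAt_phase (i j : Fin 2) (p : Plane) :
    HasDerivAt (fun s : ℝ => 2 * Real.pi * (p + Pi.single j s : Plane) i)
      (if i = j then 2 * Real.pi else 0) 0 := by
  split_ifs with hij
  · subst hij
    simpa using ((hasDerivAt_id' (0 : ℝ)).const_add (p i)).const_mul (2 * Real.pi)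
  · simpa [Pi.single_eq_of_ne hij] using hasDerivAt_const (0 : ℝ) (2 * Real.pi * p i)

theorem partialDeriv_cosCoord (i j : Fin 2) :
    partialDeriv j (cosCoord i) = fun x => -(if i = j then 2 * Real.pi else 0) * sinCoord i x := by
  funext x
  obtain ⟨p, rfl⟩ := surjective_proj x
  simp only [partialDeriv, ← proj_add, cosCoord_proj, sinCoord_proj]
  rw [(hasDerivAt_phase i j p).cos.deriv, Pi.single_zero, add_zero]
  ring

theorem partialDeriv_const_mul_sinCoord (c : ℝ) (i j : Fin 2) :
    partialDeriv j (fun x => c * sinCoord i x) =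
      fun x => c * ((if i = j then 2 * Real.pi else 0) * cosCoord i x) := by
  funext x
  obtain ⟨p, rfl⟩ := surjective_proj x
  simp only [partialDeriv, ← proj_add, cosCoord_proj, sinCoord_proj]
  rw [((hasDerivAt_phase i j p).sin.const_mul c).deriv]
  simp [mul_comm]

theorem partialDeriv_const (c : ℝ) (j : Fin 2) : partialDeriv j (fun _ => c) = fun _ => 0 := by
  funext x
  simp [partialDeriv]

theorem linearIndependent_one_cosCoord (i : Fin 2) :
    LinearIndependent ℝ ![fun _ : T2 => (1 : ℝ), cosCoord i] := by
  rw [LinearIndependent.pair_iff]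
  intro a b hab
  have h0 := congrFun hab (proj 0)
  have h1 := congrFun hab (proj fun _ => 1 / 2)
  have hpi : Real.cos (2 * Real.pi * (1 / 2)) = -1 := by
    rw [show 2 * Real.pi * (1 / 2) = Real.pi by ring, Real.cos_pi]
  simp only [Pi.add_apply, Pi.smul_apply, cosCoord_proj, smul_eq_mul, Pi.zero_apply, hpi,
    mul_zero, Real.cos_zero] at h0 h1
  constructor <;> linarith

/-- An operator `-(P ∂₀² + Q ∂₁²)` on the torus has first eigenvalue `4π² min(P, Q)`. -/
theorem isKthEigenvalue_one {F : T2 → Plane → ℝ} {P Q : ℝ} (hP : 0 < P) (hQ : 0 < Q)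
    (hF : ∀ f : T2 → ℝ, (ContDiff ℝ 2 fun p => f (proj p)) → ∀ p, laplacian F f p =
      P * partialDeriv 0 (partialDeriv 0 f) (proj p) +
        Q * partialDeriv 1 (partialDeriv 1 f) (proj p)) :
    IsKthEigenvalue F 1 (4 * Real.pi ^ 2 * min P Q) := by
  have hpi : 0 < 4 * Real.pi ^ 2 := by positivity
  have hmin : 0 < min P Q := lt_min hP hQ
  have hone : IsEigenfunction F 0 fun _ => 1 := by
    refine ⟨contDiff_const, fun h0 => one_ne_zero (congrFun h0 0), fun p => ?_⟩
    rw [hF _ contDiff_const]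
    simp [partialDeriv_const]
  have hcos : ∀ i, IsEigenfunction F (4 * Real.pi ^ 2 * if i = 0 then P else Q) (cosCoord i) := by
    intro i
    refine ⟨contDiff_cosCoord i, (linearIndependent_one_cosCoord i).ne_zero 1, fun p => ?_⟩
    rw [hF _ (contDiff_cosCoord i)]
    simp only [partialDeriv_cosCoord, partialDeriv_const_mul_sinCoord]
    fin_cases i <;> simp <;> ring
  constructor
  · obtain ⟨i, hi⟩ : ∃ i : Fin 2, (if i = 0 then P else Q) = min P Q := by
      rcases le_total P Q with hPQ | hPQ
      · exact ⟨0, by simp [hPQ]⟩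
      · exact ⟨1, by simp [hPQ]⟩
    refine ⟨![fun _ => 1, cosCoord i], linearIndependent_one_cosCoord i, fun k => ?_⟩
    fin_cases k
    · exact ⟨0, by positivity, hone⟩
    · exact ⟨_, by rw [hi], hcos i⟩
  -- Below the claimed value every eigenfunction is constant, and two constants are linearly
  -- dependent.
  · rintro t ⟨f, hli, hf⟩
    by_contra! ht
    have hconst : ∀ i, ∃ c : ℝ, ∀ x, f i x = c := by
      intro i
      obtain ⟨μ, hμ, hcd, -, heq⟩ := hf i
      have hlt := hμ.trans_lt ht
      refine eq_const_of_eigenvalue_lt (P := P) (Q := Q) (μ := μ)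
        (hlt.trans_le (mul_le_mul_of_nonneg_left (min_le_left P Q) hpi.le))
        (hlt.trans_le (mul_le_mul_of_nonneg_left (min_le_right P Q) hpi.le)) hP hQ hcd fun x => ?_
      obtain ⟨p, rfl⟩ := surjective_proj x
      rw [← hF _ hcd, heq]
    obtain ⟨c₀, h0⟩ := hconst 0
    obtain ⟨c₁, h1⟩ := hconst 1
    have h2 := Fintype.linearIndependent_iff.1 hli ![c₁, -c₀] (by
      funext x
      simp [Fin.sum_univ_two, h0, h1]
      ring) 1
    have h3 : c₀ = 0 := by simpa using h2
    exact hli.ne_zero 0 (funext fun x => by rw [h0, h3]; rfl)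

end FinslerTorus

end

theorem mainTheorem8 (h : ℝ) (hh : 1 < h) :
    (∀ η : ℝ, 0 ≤ η → η < 1 →
      FinslerTorus.IsRandersMetric (FinslerTorus.torusRanders h η) ∧
      FinslerTorus.IsFinslerMetric (FinslerTorus.torusRanders h η) ∧
      FinslerTorus.totalVolume (FinslerTorus.torusRanders h η) = 1) ∧
    ∃ η₀ : ℝ, η₀ < 1 ∧ ∀ η : ℝ, 0 ≤ η → η₀ < η → η < 1 →
      ∃ lam : ℝ, FinslerTorus.IsKthEigenvalue (FinslerTorus.torusRanders h η) 1 lam ∧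
        4 * Real.pi ^ 2 * h ^ 2 ≤ lam := by
  have h0 : 0 < h := one_pos.trans hh
  -- The threshold √(1 - h⁻⁸) is the value of η at which s = √(1 - η²) equals h⁻⁴; beyond it s ≤
  -- h⁻⁴. Being nonnegative, it also forces η > 0, as the closed form of the Laplacian requires.
  refine ⟨fun η hη hη1 => ⟨FinslerTorus.isRandersMetric_torusRanders h0.ne' hη hη1,
    FinslerTorus.isFinslerMetric_torusRanders h0.ne' hη hη1,
    FinslerTorus.totalVolume_torusRanders h0 η⟩, √(1 - (h⁻¹ ^ 4) ^ 2), ?_, ?_⟩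
  · rw [Real.sqrt_lt' one_pos]
    have : 0 < (h⁻¹ ^ 4) ^ 2 := by positivity
    linarith
  · intro η hη hη0 hη1
    have hηpos : 0 < η := (Real.sqrt_nonneg _).trans_lt hη0
    have hs : 0 < √(1 - η ^ 2) := Real.sqrt_pos.2 (by nlinarith)
    have hs1 : √(1 - η ^ 2) ≤ 1 := Real.sqrt_le_one.2 (by nlinarith)
    have hsh : √(1 - η ^ 2) ≤ h⁻¹ ^ 4 := by
      refine Real.sqrt_le_iff.2 ⟨by positivity, ?_⟩
      have := (Real.sqrt_lt' hηpos).1 hη0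
      linarith
    refine ⟨_, FinslerTorus.isKthEigenvalue_one (by positivity) (by positivity)
      fun f hf p => FinslerTorus.laplacian_torusRanders h0 hηpos hη1 hf p, ?_⟩
    refine mul_le_mul_of_nonneg_left (le_min ?_ ?_) (by positivity)
    -- P ≥ h² amounts to h⁴ s (1 + s) ≤ 2, which follows from s ≤ h⁻⁴ and s ≤ 1.
    · rw [le_div_iff₀ (by positivity)]
      have h1 : √(1 - η ^ 2) * (1 + √(1 - η ^ 2)) ≤ h⁻¹ ^ 4 * 2 :=
        mul_le_mul hsh (by linarith) (by positivity) (by positivity)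
      calc h ^ 2 * (h ^ 2 * (√(1 - η ^ 2) * (1 + √(1 - η ^ 2))))
          ≤ h ^ 2 * (h ^ 2 * (h⁻¹ ^ 4 * 2)) := by gcongr
        _ = 2 := by field_simp
    · rw [le_div_iff₀ (by positivity)]
      nlinarith [sq_nonneg h]
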